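/- **Setting.** Let $(N,E)$ be a finite connected graph with an arbitrary orientation, $E\subseteq N\times N$, so that $(i,j)\in E$ implies $(j,i)\notin E$. For $j\in N$ and $(i,j)\in E$ let $M_j>0$, $B_{ij}>0$, $p^L_j\in\mathbb R$, $\overline d_j\ge 0$ and $\omega^1_j>\omega^0_j>0$ be constants, let $n_j\in\mathbb N$, and let $f_j:\mathbb R^{n_j}\times\mathbb R\to\mathbb R^{n_j}$ and $g_j:\mathbb R^{n_j}\times\mathbb R\to\mathbb R$ be globally Lipschitz. The continuous state is $x=(\eta,\omega,x^s)$ with $\eta\in\mathbb R^{E}$, $\omega\in\mathbb R^{N}$, $x^s_j\in\mathbb R^{n_j}$, and the discrete state is $\sigma\in\{-1,0,1\}^{N}$; write $z=(x,\sigma)$. Let $\mathcal I_j(\omega_j)=\{0\}$ if $|\omega_j|<\omega_j^0$, $\mathcal I_j(\omega_j)=\{0,\operatorname{sgn}\omega_j\}$ if $\omega^0_j\le|\omega_j|\le\omega^1_j$, $\mathcal I_j(\omega_j)=\{\operatorname{sgn}\omega_j\}$ if $|\omega_j|>\omega^1_j$, and write $\sigma\in\mathcal I(\omega)$ if $\sigma_j\in\mathcal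 I_j(\omega_j)$ for all $j$. On the flow set $C=\{z:\sigma\in\mathcal I(\omega)\}$ the state follows $\dot z=f(z)$, that is, $$\dot\eta_{ij}=\omega_i-\omega_j\ \ ((i,j)\in E),\qquad \dot x^s_j=f_j(x^s_j,-\omega_j),\qquad \dot\sigma_j=0,$$ $$M_j\dot\omega_j=-p^L_j+g_j(x^s_j,-\omega_j)-\overline d_j\sigma_j-\sum_{k:(j,k)\in E}B_{jk}\sin\eta_{jk}+\sum_{i:(i,j)\in E}B_{ij}\sin\eta_{ij}\qquad(j\in N).$$ The jump set $D$ consists of those $z$ with $\sigma\in\mathcal I(\omega)$ for which some load $j$ satisfies ($|\omega_j|=\omega^1_j$ and $\sigma_j=0$) or ($|\omega_j|=\omega^0_j$ and $\sigma_j=\operatorname{sgn}\omega_j$). On $D$ the state jumps by $z^+=g(z)$: $x^+=x$, and $\sigma_j^+=\operatorname{sgn}\omega_j$ if $|\omega_j|=\omega_j^1$, $\sigma_j^+=0$ if $|\omega_j|=\omega_j^0$, $\sigma_j^+=\sigma_j$ otherwise. Solutions are maximal solutions $z(t,\ell)$ of this hybrid system, defined on hybrid time domains $K\subseteq\mathbb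 R_{\ge0}\times\mathbb N_0$; a solution is complete if $K$ is unbounded. An equilibrium is a point $z\in C\cup D$ with $f(z)=0$ if $z\in C$ and $g(z)=z$ if $z\in D$. **Assumptions.** 1. For every $j$ there is $\bar x$ with $f_j(\bar x,0)=0$; and for every constant $\bar\omega_j$, every compact set that is invariant (forwards and backwards in time) under $\dot x=f_j(x,-\bar\omega_j)$ consists of equilibrium points of this equation. 2. There is a bus $j$ such that $f_j(\bar x,-\bar\omega)=0$ implies $\bar\omega=0$. 3. $z^*=(\eta^*,\omega^*,x^{s,*},\sigma^*)$ is an equilibrium of the hybrid system. 4. For every $j$ there are open neighbourhoods $\Omega_j$ of $-\omega_j^*$ and $X_j$ of $x^{s,*}_j$, a $C^1$ function $V_j:\mathbb R^{n_j}\to[0,\infty)$ with a strict local minimum at $x^{s,*}_j$, and a function $\phi_j:\mathbb R\to\mathbb R$ with $\phi_j(0)=0$ and $\phi_j(v)>0$ for $v\ne0$, such that for all $u\in\Omega_j$ and $x\in X_j$ $$\nabla V_j(x)\cdot f_j(x,u)\le (u+\omega^*_j)\bigl(g_j(x,u)-g_j(x^{s,*}_j,-\omega^*_j)\bigr)-\phi_j(u+\omega_j^*).$$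 5. $|\eta^*_{ij}|<\pi/2$ for all $(i,j)\in E$. **Theorem 2.** Under these assumptions there is an open neighbourhood $S$ of $x^*=(\eta^*,\omega^*,x^{s,*})$ such that every solution $z=(x,\sigma)$ with $x(0,0)\in S$ and $\sigma(0,0)\in\mathcal I(\omega(0,0))$ is complete and converges to the set of equilibria of the hybrid system: the distance of $z(t,\ell)$ to that set tends to $0$ as $t+\ell\to\infty$, $(t,\ell)\in K$. In particular $\omega(t,\ell)\to0$ and $\sigma(t,\ell)\to0$. -/

import Mathlib

open Filter Topology MeasureTheory

/-! ### Hybrid systems, their solutions and equilibria -/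

/-- The data `(C, f, D, g)` of a hybrid system `ż = f(z)` on the flow set `C`,
`z⁺ = g(z)` on the jump set `D`. -/
structure HybridSystem (Z : Type*) where
  /-- the flow set `C` -/
  flowSet : Set Z
  /-- the flow map `f` -/
  flow : Z → Z
  /-- the jump set `D` -/
  jumpSet : Set Z
  /-- the jump map `g` -/
  jump : Z → Z

/-- Hybrid time domains: unions of an infinite sequence of intervals `[t_ℓ, t_{ℓ+1}] × {ℓ}`
(starting at `t₀ = 0`), or of a finite such sequence whose last interval, with index `J`, has one of
the forms `[t_J, T] × {J}`, `[t_J, T) × {J}`, `[t_J, ∞) × {J}`. -/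
def IsHybridTimeDomain (K : Set (ℝ × ℕ)) : Prop :=
  ∃ t : ℕ → ℝ, t 0 = 0 ∧ Monotone t ∧
    (K = {p | p.1 ∈ Set.Icc (t p.2) (t (p.2 + 1))} ∨
      ∃ (J : ℕ) (I : Set ℝ),
        ((∃ T, t J ≤ T ∧ I = Set.Icc (t J) T) ∨
          (∃ T, t J < T ∧ I = Set.Ico (t J) T) ∨
          I = Set.Ici (t J)) ∧
        K = {p | (p.2 < J ∧ p.1 ∈ Set.Icc (t p.2) (t (p.2 + 1))) ∨ (p.2 = J ∧ p.1 ∈ I)})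

/-- The slice `T_ℓ = {t : (t, ℓ) ∈ K}`. -/
def hybridSlice (K : Set (ℝ × ℕ)) (l : ℕ) : Set ℝ := {t | (t, l) ∈ K}

/-- Local absolute continuity on an interval `T`: absolute continuity on every compact
subinterval. -/
def LocallyAbsContOn {Z : Type*} [PseudoMetricSpace Z] (x : ℝ → Z) (T : Set ℝ) : Prop :=
  ∀ a b : ℝ, a ≤ b → Set.Icc a b ⊆ T → AbsolutelyContinuousOnInterval x a b

/-- The filter on hybrid times that expresses `t + ℓ → ∞` with `(t, ℓ) ∈ K`. -/
def hybridAtTop (K : Set (ℝ × ℕ)) : Filter (ℝ × ℕ) :=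
  comap (fun p : ℝ × ℕ => p.1 + (p.2 : ℝ)) atTop ⊓ 𝓟 K

namespace HybridSystem

variable {Z : Type*} [NormedAddCommGroup Z] [NormedSpace ℝ Z]

/-- `z`, restricted to the hybrid time domain `K`, is a solution. Values of `z` outside `K` play no
role. -/
structure IsSolution (H : HybridSystem Z) (K : Set (ℝ × ℕ)) (z : ℝ × ℕ → Z) : Prop where
  domain : IsHybridTimeDomain K
  locallyAbsCont : ∀ l, LocallyAbsContOn (fun t => z (t, l)) (hybridSlice K l)
  init : z (0, 0) ∈ H.flowSet ∪ H.jumpSet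
  flow_mem : ∀ l, ∀ t ∈ interior (hybridSlice K l), z (t, l) ∈ H.flowSet
  flow_eq : ∀ l, (interior (hybridSlice K l)).Nonempty →
    ∀ᵐ t : ℝ, t ∈ hybridSlice K l → HasDerivAt (fun s => z (s, l)) (H.flow (z (t, l))) t
  jump_eq : ∀ t l, (t, l) ∈ K → (t, l + 1) ∈ K →
    z (t, l) ∈ H.jumpSet ∧ z (t, l + 1) = H.jump (z (t, l))

/-- A solution is maximal if no solution with a strictly larger time domain extends it. -/
def IsMaximalSolution (H : HybridSystem Z) (K : Set (ℝ × ℕ)) (z : ℝ × ℕ → Z) : Prop :=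
  H.IsSolution K z ∧
    ¬ ∃ (K' : Set (ℝ × ℕ)) (z' : ℝ × ℕ → Z),
      H.IsSolution K' z' ∧ K ⊂ K' ∧ ∀ p ∈ K, z' p = z p

/-- Equilibria: points of `C ∪ D` with `f(z) = 0` when `z ∈ C`, and `g(z) = z` when `z ∈ D`. -/
def equilibria (H : HybridSystem Z) : Set Z :=
  {z | z ∈ H.flowSet ∪ H.jumpSet ∧ (z ∈ H.flowSet → H.flow z = 0) ∧
    (z ∈ H.jumpSet → H.jump z = z)}

end HybridSystem

/-! ### Input-output systems `ẋ = f(x, u)`, `s = g(x, u)` -/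

/-- `K` is invariant (forwards and backwards in time) under `ẋ = F(x)`: through every point of `K`
there is a solution that is defined on all of `ℝ` and stays in `K`. -/
def IsInvariantSet {X : Type*} [NormedAddCommGroup X] [NormedSpace ℝ X]
    (F : X → X) (K : Set X) : Prop :=
  ∀ x₀ ∈ K, ∃ x : ℝ → X, x 0 = x₀ ∧ (∀ t, HasDerivAt x (F (x t)) t) ∧ ∀ t, x t ∈ K

/-- `V` is a storage function witnessing that the system `ẋ = f(x, u)`, `s = g(x, u)` is locally
input strictly passive around the constant input `u₀` and the point `x₀`. The derivative of `V`
along the system is `fderiv ℝ V x (f (x, u))`. -/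
structure IsPassivityStorage {X : Type*} [NormedAddCommGroup X] [NormedSpace ℝ X]
    (f : X × ℝ → X) (g : X × ℝ → ℝ) (u₀ : ℝ) (x₀ : X) (V : X → ℝ) : Prop where
  contDiff : ContDiff ℝ 1 V
  nonneg : ∀ x, 0 ≤ V x
  dissipation : ∃ (U : Set ℝ) (Y : Set X) (φ : ℝ → ℝ),
    IsOpen U ∧ u₀ ∈ U ∧ IsOpen Y ∧ x₀ ∈ Y ∧
    φ 0 = 0 ∧ (∀ v, v ≠ 0 → 0 < φ v) ∧
    ∀ u ∈ U, ∀ x ∈ Y,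
      fderiv ℝ V x (f (x, u)) ≤ (u - u₀) * (g (x, u) - g (x₀, u₀)) - φ (u - u₀)

/-! ### The power network with hysteretic on-off loads -/

/-- `1` for non-negative arguments and `-1` otherwise. -/
noncomputable def gridSgn (w : ℝ) : ℝ := if 0 ≤ w then 1 else -1

/-- The data of a power network with set of buses `N`, supply dynamics at the buses, and hysteretic
on-off loads. -/
structure PowerNetwork (N : Type*) where
  /-- the set of lines, with an arbitrary orientation -/
  E : Finset (N × N)
  oriented : ∀ i j, (i, j) ∈ E → (j, i) ∉ E
  connected : (SimpleGraph.fromRel fun i j => (i, j) ∈ E).Connected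
  /-- generator inertia -/
  M : N → ℝ
  M_pos : ∀ j, 0 < M j
  /-- line susceptances -/
  B : E → ℝ
  B_pos : ∀ e, 0 < B e
  /-- frequency-independent load -/
  pL : N → ℝ
  /-- dimension of the state of the supply dynamics at each bus -/
  dim : N → ℕ
  /-- vector field of the supply dynamics, as a function of the state and of the input `-ω_j` -/
  f : ∀ j, EuclideanSpace ℝ (Fin (dim j)) × ℝ → EuclideanSpace ℝ (Fin (dim j))
  f_lipschitz : ∀ j, ∃ L, LipschitzWith L (f j)
  /-- output `s_j` of the supply dynamics -/
  g : ∀ j, EuclideanSpace ℝ (Fin (dim j)) × ℝ → ℝ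
  g_lipschitz : ∀ j, ∃ L, LipschitzWith L (g j)
  /-- size of the on-off load -/
  dbar : N → ℝ
  dbar_nonneg : ∀ j, 0 ≤ dbar j
  /-- lower frequency threshold -/
  w0 : N → ℝ
  /-- upper frequency threshold -/
  w1 : N → ℝ
  w0_pos : ∀ j, 0 < w0 j
  w0_lt_w1 : ∀ j, w0 j < w1 j

namespace PowerNetwork

variable {N : Type*}

/-- The continuous state `x = (η, ω, xˢ)`. -/
abbrev ContState (G : PowerNetwork N) : Type _ :=
  (G.E → ℝ) × (N → ℝ) × (∀ j, EuclideanSpace ℝ (Fin (G.dim j)))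

/-- The ambient space of the hybrid state `z = (x, σ)`; the values of `σ` are confined to
`{-1, 0, 1}` by the flow and jump sets below. -/
abbrev State (G : PowerNetwork N) : Type _ := G.ContState × (N → ℝ)

/-- the angle differences `η` -/
def eta {G : PowerNetwork N} (x : G.ContState) : G.E → ℝ := x.1

/-- the frequency deviations `ω` -/
def omega {G : PowerNetwork N} (x : G.ContState) : N → ℝ := x.2.1

/-- the states `xˢ` of the supply dynamics -/
def supply {G : PowerNetwork N} (x : G.ContState) (j : N) : EuclideanSpace ℝ (Fin (G.dim j)) :=
  x.2.2 j

/-- The set of values of `σ_j` that are compatible with the frequency `w` at bus `j`. -/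
noncomputable def compat (G : PowerNetwork N) (j : N) (w : ℝ) : Set ℝ :=
  if |w| < G.w0 j then {0}
  else if |w| ≤ G.w1 j then {0, gridSgn w}
  else {gridSgn w}

/-- The domain `Λ` of the hybrid state. -/
def domain (G : PowerNetwork N) : Set G.State :=
  {z | ∀ j, z.2 j ∈ ({-1, 0, 1} : Set ℝ) ∧ z.2 j ∈ G.compat j (omega z.1 j)}

/-- The flow set. -/
def C (G : PowerNetwork N) : Set G.State :=
  {z | z ∈ G.domain ∧ ∀ j, z.2 j ∈ G.compat j (omega z.1 j)}

/-- The load at bus `j` is about to switch: its frequency is at the upper threshold and the load is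
off, or its frequency is at the lower threshold and the load is on. -/
def Switches (G : PowerNetwork N) (z : G.State) (j : N) : Prop :=
  (|omega z.1 j| = G.w1 j ∧ z.2 j = 0) ∨
    (|omega z.1 j| = G.w0 j ∧ z.2 j = gridSgn (omega z.1 j))

/-- The jump set: some load is about to switch. -/
def D (G : PowerNetwork N) : Set G.State := {z | z ∈ G.domain ∧ ∃ j, G.Switches z j}

open Classical in
/-- The jump map: `x⁺ = x`, and the loads at one of their thresholds are updated, the others are
unchanged. -/
noncomputable def jumpMap (G : PowerNetwork N) (z : G.State) : G.State :=
  (z.1, fun j =>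
    if |omega z.1 j| = G.w1 j then gridSgn (omega z.1 j)
    else if |omega z.1 j| = G.w0 j then 0
    else z.2 j)

/-- The power `p_ij = B_ij sin η_ij` transmitted along a line. -/
noncomputable def lineFlow (G : PowerNetwork N) (x : G.ContState) (e : G.E) : ℝ :=
  G.B e * Real.sin (eta x e)

/-- The flow map: the swing equations coupled to the supply dynamics, with loads `dbar_j σ_j`, and
`σ̇ = 0`. -/
noncomputable def flowMap [DecidableEq N] (G : PowerNetwork N) (z : G.State) : G.State :=
  ((fun e => omega z.1 e.1.1 - omega z.1 e.1.2,
    fun j => (G.M j)⁻¹ * (-G.pL j + G.g j (supply z.1 j, -omega z.1 j) - G.dbar j * z.2 j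
      - ∑ e : G.E with e.1.1 = j, G.lineFlow z.1 e
      + ∑ e : G.E with e.1.2 = j, G.lineFlow z.1 e),
    fun j => G.f j (supply z.1 j, -omega z.1 j)),
   fun _ => 0)

/-- The hybrid system of the network with hysteretic on-off loads. -/
noncomputable def hybrid [DecidableEq N] (G : PowerNetwork N) : HybridSystem G.State where
  flowSet := G.C
  flow := G.flowMap
  jumpSet := G.D
  jump := G.jumpMap

/-- At each bus, the supply dynamics have an equilibrium for `ω_j = 0`, and for constant inputs
their compact invariant sets consist of equilibrium points only. -/
def SupplyRegular (G : PowerNetwork N) : Prop :=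
  ∀ j, (∃ x, G.f j (x, 0) = 0) ∧
    ∀ (w : ℝ) (K : Set (EuclideanSpace ℝ (Fin (G.dim j)))), IsCompact K →
      IsInvariantSet (fun x => G.f j (x, -w)) K → ∀ x ∈ K, G.f j (x, -w) = 0

/-- At some bus, the supply dynamics are at rest only at nominal frequency. -/
def NominalFrequency (G : PowerNetwork N) : Prop :=
  ∃ j, ∀ x (w : ℝ), G.f j (x, -w) = 0 → w = 0

/-- The supply dynamics at each bus are locally input strictly passive around the values that they
have at `x`, with a storage function that has a strict local minimum there. -/
def PassiveAt (G : PowerNetwork N) (x : G.ContState) : Prop :=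
  ∀ j, ∃ V, IsPassivityStorage (G.f j) (G.g j) (-omega x j) (supply x j) V ∧
    ∀ᶠ y in 𝓝[≠] (supply x j), V (supply x j) < V y

end PowerNetwork

/-! The hysteresis plays no role near `zstar`. At an equilibrium the frequencies at the two ends of
each line agree, hence all frequencies by connectedness, and `NominalFrequency` makes the common
value zero; so every load is off. On a small ball around `zstar.1` all frequencies stay below the
lower thresholds, where `σ = 0` is the only admissible discrete state and no point lies in the jump
set. What remains is convergence for the globally Lipschitz equation `ẋ = offField x`.

The Lyapunov function is `energy`: kinetic energy, plus for each line the gap between the cosine and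
its tangent at the equilibrium angle (positive since all angles are below `π/2`), plus the storage
functions. The exchange between kinetic and line energy cancels (`hasDerivAt_energy`), and strict
passivity bounds the rate by minus the sum of the `φ_j(-ω_j)`. So the energy does not increase in
the ball and is stationary only where all frequencies vanish (`exists_energy_ball`). Starting below
the minimum of the energy on the bounding sphere, a curve cannot leave the ball
(`mem_ball_of_lyapunov`).

By `LipschitzWith.laSalle`, limit points move along trajectories with zero frequency. Their supply
states at one bus then form a compact invariant set for zero input, hence consist of equilibria by
`SupplyRegular`; all limit points are stationary (`stationary_of_mapClusterPt`), and compactness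
turns this into convergence.

Finally, a hybrid solution is only absolutely continuous and may a priori jump or stop; uniqueness
for Carathéodory solutions and maximality identify it with the classical curve on `[0, ∞) × {0}`
(`maximalSolution_eq_off`). -/

/-! ### Existence, uniqueness and dependence on initial data for Lipschitz equations -/

section GlobalODE

variable {E : Type*} [NormedAddCommGroup E] [NormedSpace ℝ E] {F : E → E} {L : NNReal}

/-- A Lipschitz vector field has local solutions whose time of existence is uniform in the initial
point. -/
theorem LipschitzWith.exists_uniform_local_solution [CompleteSpace E] (hF : LipschitzWith L F)
    (t₀ : ℝ) (x₀ : E) :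
    ∃ γ : ℝ → E, γ t₀ = x₀ ∧ ∀ t ∈ Set.Icc (t₀ - 1 / (1 + L)) (t₀ + 1 / (1 + L)),
      HasDerivWithinAt γ (F (γ t)) (Set.Icc (t₀ - 1 / (1 + L)) (t₀ + 1 / (1 + L))) t := by
  have hL : (0 : ℝ) < 1 / (1 + L) := by positivity
  have ht : t₀ ∈ Set.Icc (t₀ - 1 / (1 + (L : ℝ))) (t₀ + 1 / (1 + L)) := ⟨by linarith, by linarith⟩
  -- On the ball of radius `‖F x₀‖` the Lipschitz bound gives `‖F‖ ≤ (1 + L) ‖F x₀‖`, so speed times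
  -- `1 / (1 + L)` is at most the radius, whatever `x₀` is.
  have key : IsPicardLindelof (fun _ => F)
      (⟨t₀, ht⟩ : Set.Icc (t₀ - 1 / (1 + (L : ℝ))) (t₀ + 1 / (1 + L))) x₀
      ‖F x₀‖₊ 0 (‖F x₀‖₊ * (1 + L)) L := by
    refine IsPicardLindelof.of_time_independent (fun x hx => ?_) hF.lipschitzOnWith ?_
    · have h1 := hF.dist_le_mul x x₀
      rw [dist_eq_norm] at h1
      have h2 : dist x x₀ ≤ ‖F x₀‖ := hx
      have h3 : ‖F x‖ ≤ ‖F x - F x₀‖ + ‖F x₀‖ := by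
        simpa using norm_add_le (F x - F x₀) (F x₀)
      have h4 : (L : ℝ) * dist x x₀ ≤ L * ‖F x₀‖ := by gcongr
      push_cast
      linarith
    · have : max (t₀ + 1 / (1 + (L : ℝ)) - t₀) (t₀ - (t₀ - 1 / (1 + L))) = 1 / (1 + L) := by
        rw [add_sub_cancel_left, sub_sub_cancel, max_self]
      rw [this]
      push_cast
      rw [sub_zero, mul_assoc, mul_one_div_cancel (by positivity), mul_one]
  exact key.exists_eq_forall_mem_Icc_hasDerivWithinAt₀

/-- Two solutions on an open interval that agree at one point agree everywhere. -/
theorem LipschitzWith.solution_eqOn_Ioo (hF : LipschitzWith L F) {X Y : ℝ → E} {a b t₀ : ℝ}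
    (hX : ∀ t ∈ Set.Ioo a b, HasDerivAt X (F (X t)) t)
    (hY : ∀ t ∈ Set.Ioo a b, HasDerivAt Y (F (Y t)) t) (ht₀ : t₀ ∈ Set.Ioo a b)
    (h0 : X t₀ = Y t₀) : Set.EqOn X Y (Set.Ioo a b) :=
  ODE_solution_unique_of_mem_Ioo (v := fun _ => F) (s := fun _ => Set.univ) (K := L)
    (fun _ _ => hF.lipschitzOnWith) ht₀ (fun t ht => ⟨hX t ht, trivial⟩)
    (fun t ht => ⟨hY t ht, trivial⟩) h0

/-- Off a closed interval the derivative within it is vacuous, so each hypothesis is needed only on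
its own interval. -/
theorem HasDerivWithinAt.Icc_union_Icc {γ : ℝ → E} {v : E} {a b c t : ℝ} (hab : a ≤ b)
    (hbc : b ≤ c) (h₁ : t ∈ Set.Icc a b → HasDerivWithinAt γ v (Set.Icc a b) t)
    (h₂ : t ∈ Set.Icc b c → HasDerivWithinAt γ v (Set.Icc b c) t) :
    HasDerivWithinAt γ v (Set.Icc a c) t := by
  have aux : ∀ p q : ℝ, (t ∈ Set.Icc p q → HasDerivWithinAt γ v (Set.Icc p q) t) →
      HasDerivWithinAt γ v (Set.Icc p q) t := by
    intro p q h
    by_cases ht : t ∈ Set.Icc p q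
    · exact h ht
    · exact HasFDerivWithinAt.of_notMem_closure (by rwa [isClosed_Icc.closure_eq])
  rw [← Set.Icc_union_Icc_eq_Icc hab hbc]
  exact (aux _ _ h₁).union (aux _ _ h₂)

/-- A solution on a compact interval can be continued by solutions that start at its end points. -/
theorem exists_solution_Icc_glue {γ α β : ℝ → E} {p q r s : ℝ} (hpq : p ≤ q) (hqr : q < r)
    (hrs : r ≤ s) (hγ : ∀ t ∈ Set.Icc q r, HasDerivWithinAt γ (F (γ t)) (Set.Icc q r) t)
    (hα : ∀ t ∈ Set.Icc r s, HasDerivWithinAt α (F (α t)) (Set.Icc r s) t)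
    (hβ : ∀ t ∈ Set.Icc p q, HasDerivWithinAt β (F (β t)) (Set.Icc p q) t)
    (hαγ : α r = γ r) (hβγ : β q = γ q) :
    ∃ δ : ℝ → E, Set.EqOn δ γ (Set.Icc q r) ∧
      ∀ t ∈ Set.Icc p s, HasDerivWithinAt δ (F (δ t)) (Set.Icc p s) t := by
  classical
  let δ : ℝ → E := fun t => if t ≤ q then β t else if t ≤ r then γ t else α t
  have e1 : Set.EqOn δ β (Set.Icc p q) := fun t ht => by simp [δ, ht.2]
  have e2 : Set.EqOn δ γ (Set.Icc q r) := fun t ht => by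
    rcases ht.1.eq_or_lt with rfl | h
    · simp [δ, hβγ]
    · simp [δ, h.not_ge, ht.2]
  have e3 : Set.EqOn δ α (Set.Icc r s) := fun t ht => by
    have hqt : ¬ t ≤ q := (hqr.trans_le ht.1).not_ge
    rcases ht.1.eq_or_lt with rfl | h
    · simp [δ, hqt, hαγ]
    · simp [δ, hqt, h.not_ge]
  refine ⟨δ, e2, fun t _ => ?_⟩
  refine HasDerivWithinAt.Icc_union_Icc hpq (hqr.le.trans hrs) (fun h => ?_) (fun _ => ?_)
  · rw [e1 h]; exact (hβ t h).congr e1 (e1 h)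
  · refine HasDerivWithinAt.Icc_union_Icc hqr.le hrs (fun h => ?_) (fun h => ?_)
    · rw [e2 h]; exact (hγ t h).congr e2 (e2 h)
    · rw [e3 h]; exact (hα t h).congr e3 (e3 h)

/-- A Lipschitz vector field is complete. -/
theorem LipschitzWith.exists_global_solution [CompleteSpace E] (hF : LipschitzWith L F) (x₀ : E) :
    ∃ X : ℝ → E, X 0 = x₀ ∧ ∀ t, HasDerivAt X (F (X t)) t := by
  obtain ⟨ε, hε, hloc⟩ : ∃ ε : ℝ, 0 < ε ∧ ∀ (t₀ : ℝ) (x₀ : E), ∃ γ : ℝ → E, γ t₀ = x₀ ∧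
      ∀ t ∈ Set.Icc (t₀ - ε) (t₀ + ε),
        HasDerivWithinAt γ (F (γ t)) (Set.Icc (t₀ - ε) (t₀ + ε)) t :=
    ⟨1 / (1 + L), by positivity, hF.exists_uniform_local_solution⟩
  have hind : ∀ n : ℕ, ∃ γ : ℝ → E, γ 0 = x₀ ∧
      ∀ t ∈ Set.Icc (-((n + 1) * ε)) ((n + 1) * ε),
        HasDerivWithinAt γ (F (γ t)) (Set.Icc (-((n + 1) * ε)) ((n + 1) * ε)) t := by
    intro n
    induction n with
    | zero => simpa using hloc 0 x₀
    | succ n ih =>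
      obtain ⟨γ, h0, hγ⟩ := ih
      set b : ℝ := (n + 1) * ε with hb
      have hbpos : 0 < b := by positivity
      obtain ⟨α, hα0, hα⟩ := hloc b (γ b)
      obtain ⟨β, hβ0, hβ⟩ := hloc (-b) (γ (-b))
      have hs1 : Set.Icc b (b + ε) ⊆ Set.Icc (b - ε) (b + ε) :=
        Set.Icc_subset_Icc_left (by linarith)
      have hs2 : Set.Icc (-b - ε) (-b) ⊆ Set.Icc (-b - ε) (-b + ε) :=
        Set.Icc_subset_Icc_right (by linarith)
      obtain ⟨δ, hδγ, hδ⟩ := exists_solution_Icc_glue (F := F) (p := -b - ε) (q := -b) (r := b)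
        (s := b + ε) (by linarith) (by linarith) (by linarith) hγ
        (fun t ht => (hα t (hs1 ht)).mono hs1) (fun t ht => (hβ t (hs2 ht)).mono hs2) hα0 hβ0
      have e : ((n + 1 : ℕ) + 1 : ℝ) * ε = b + ε := by rw [hb]; push_cast; ring
      refine ⟨δ, by rw [hδγ ⟨by linarith, hbpos.le⟩, h0], ?_⟩
      rw [e, show -(b + ε) = -b - ε by ring]
      exact hδ
  choose γ h0 hγ using hind
  have hγ' : ∀ n : ℕ, ∀ t ∈ Set.Ioo (-((n + 1) * ε)) ((n + 1) * ε),
      HasDerivAt (γ n) (F (γ n t)) t := fun n t ht =>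
    (hγ n t (Set.Ioo_subset_Icc_self ht)).hasDerivAt (Icc_mem_nhds ht.1 ht.2)
  have hmono : ∀ m n : ℕ, m ≤ n → ((m : ℝ) + 1) * ε ≤ (n + 1) * ε := fun m n h => by
    have : (m : ℝ) ≤ n := by exact_mod_cast h
    gcongr
  have hagree : ∀ m n : ℕ, m ≤ n →
      Set.EqOn (γ m) (γ n) (Set.Ioo (-((m + 1) * ε)) ((m + 1) * ε)) := fun m n h =>
    hF.solution_eqOn_Ioo (t₀ := 0) (hγ' m)
      (fun t ht => hγ' n t ⟨by linarith [hmono m n h, ht.1], by linarith [hmono m n h, ht.2]⟩)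
      ⟨by rw [neg_lt_zero]; positivity, by positivity⟩ ((h0 m).trans (h0 n).symm)
  -- The window of index `n t` contains `t` strictly inside, which turns the derivative within the
  -- window into a two-sided one.
  let n : ℝ → ℕ := fun t => ⌈|t| / ε⌉₊
  have hn : ∀ t, |t| < (n t + 1) * ε := fun t => by
    have := Nat.le_ceil (|t| / ε)
    rw [div_le_iff₀ hε] at this
    calc |t| ≤ n t * ε := this
      _ < (n t + 1) * ε := by nlinarith
  refine ⟨fun t => γ (n t) t, h0 _, fun t => ?_⟩
  have hev : (fun s => γ (n s) s) =ᶠ[𝓝 t] γ (n t) := by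
    have := abs_lt.1 (hn t)
    filter_upwards [Ioo_mem_nhds this.1 this.2] with s hs
    rcases le_total (n s) (n t) with h | h
    · exact hagree _ _ h (abs_lt.1 (hn s))
    · exact (hagree _ _ h hs).symm
  exact (hγ' (n t) t (abs_lt.1 (hn t))).congr_of_eventuallyEq hev

/-- Carathéodory solutions of a Lipschitz differential equation are classical solutions. -/
theorem LipschitzWith.eqOn_of_absolutelyContinuous [CompleteSpace E] (hF : LipschitzWith L F)
    {y X : ℝ → E} {T : ℝ} (hT : 0 ≤ T) (hy : AbsolutelyContinuousOnInterval y 0 T)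
    (hy' : ∀ᵐ t : ℝ, t ∈ Set.Icc 0 T → HasDerivAt y (F (y t)) t)
    (hX : ∀ t, HasDerivAt X (F (X t)) t) (h0 : X 0 = y 0) : Set.EqOn y X (Set.Icc 0 T) := by
  have hu : Set.uIcc 0 T = Set.Icc 0 T := Set.uIcc_of_le hT
  have hyc : ContinuousOn y (Set.Icc 0 T) := hu ▸ hy.continuousOn
  -- Extending `F ∘ y` by its end values makes its primitive `Y` continuously differentiable on all
  -- of `ℝ`; then `y - Y` is absolutely continuous with zero derivative almost everywhere, hence
  -- constant.
  let h : ℝ → E := Set.IccExtend hT ((Set.Icc 0 T).domRestrict (F ∘ y))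
  have hc : Continuous h :=
    ((hF.continuous.comp_continuousOn hyc).domRestrict).Icc_extend'
  have hh : ∀ t ∈ Set.Icc 0 T, h t = F (y t) := fun t ht => by
    simp only [h, Set.IccExtend_of_mem hT _ ht]; rfl
  let Y : ℝ → E := fun t => y 0 + ∫ s in (0 : ℝ)..t, h s
  have hY : ∀ t, HasDerivAt Y (h t) t := fun t =>
    (hc.integral_hasStrictDerivAt 0 t).hasDerivAt.const_add _
  have hYac : AbsolutelyContinuousOnInterval Y 0 T := by
    refine ContDiffOn.absolutelyContinuousOnInterval (ContDiff.contDiffOn ?_)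
    rw [contDiff_one_iff_deriv]
    refine ⟨fun t => (hY t).differentiableAt, ?_⟩
    rw [show deriv Y = h from funext fun t => (hY t).deriv]
    exact hc
  obtain ⟨c, hcst⟩ := (hy.sub hYac).const_of_ae_hasDerivAt_zero (by
    filter_upwards [hy'] with t ht htm
    rw [hu] at htm
    simpa [hh t htm] using (ht htm).sub (hY t))
  have hc0 : c = 0 := by
    rw [← hcst 0 Set.left_mem_uIcc]
    simp [Y]
  have hyY : Set.EqOn y Y (Set.Icc 0 T) := fun t ht => by
    have := hcst t (hu ▸ ht)
    rw [hc0] at this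
    exact sub_eq_zero.1 this
  have hYX : Set.EqOn Y X (Set.Icc 0 T) := by
    refine ODE_solution_unique (v := fun _ => F) (K := L) (fun _ => hF)
      (fun t _ => (hY t).continuousAt.continuousWithinAt) (fun t ht => ?_)
      (fun t _ => (hX t).continuousAt.continuousWithinAt) (fun t _ => (hX t).hasDerivWithinAt)
      (by simp [Y, h0])
    have htm := Set.Ico_subset_Icc_self ht
    rw [← hyY htm, ← hh t htm]
    exact (hY t).hasDerivWithinAt
  exact hyY.trans hYX

/-- Grönwall's inequality; negative times follow by reversing time, as `-F` has the same Lipschitz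
constant. Both directions serve the two-sided invariance of limit sets. -/
theorem LipschitzWith.dist_solution_le (hF : LipschitzWith L F) {X Y : ℝ → E}
    (hX : ∀ t, HasDerivAt X (F (X t)) t) (hY : ∀ t, HasDerivAt Y (F (Y t)) t) (s : ℝ) :
    dist (X s) (Y s) ≤ dist (X 0) (Y 0) * Real.exp (L * |s|) := by
  rcases le_total 0 s with hs | hs
  · have := dist_le_of_trajectories_ODE (v := fun _ => F) (K := L) (a := 0) (b := s)
      (fun _ => hF) (fun t _ => (hX t).continuousAt.continuousWithinAt)
      (fun t _ => (hX t).hasDerivWithinAt) (fun t _ => (hY t).continuousAt.continuousWithinAt)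
      (fun t _ => (hY t).hasDerivWithinAt) le_rfl s ⟨hs, le_rfl⟩
    simpa [abs_of_nonneg hs] using this
  · have hrev : ∀ {Z : ℝ → E}, (∀ t, HasDerivAt Z (F (Z t)) t) →
        ∀ t, HasDerivAt (fun t => Z (-t)) (-F (Z (-t))) t := fun hZ t => by
      simpa [Function.comp_def] using (hZ (-t)).scomp t (hasDerivAt_neg t)
    have := dist_le_of_trajectories_ODE (v := fun _ x => -F x) (K := L) (a := 0) (b := -s)
      (fun _ => hF.neg) (fun t _ => (hrev hX t).continuousAt.continuousWithinAt)
      (fun t _ => (hrev hX t).hasDerivWithinAt)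
      (fun t _ => (hrev hY t).continuousAt.continuousWithinAt)
      (fun t _ => (hrev hY t).hasDerivWithinAt) le_rfl (-s) ⟨by linarith, le_rfl⟩
    simpa [abs_of_nonpos hs] using this

/-- The set of limit points of a solution is invariant. -/
theorem LipschitzWith.mapClusterPt_solution (hF : LipschitzWith L F) {X Y : ℝ → E}
    (hX : ∀ t, HasDerivAt X (F (X t)) t) (hY : ∀ t, HasDerivAt Y (F (Y t)) t)
    (h : MapClusterPt (Y 0) atTop X) (s : ℝ) : MapClusterPt (Y s) atTop X := by
  rw [mapClusterPt_iff_frequently] at h ⊢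
  intro U hU
  obtain ⟨ε, hε, hεU⟩ := Metric.mem_nhds_iff.1 hU
  -- The radius is shrunk by the factor by which distances can grow during time `s`.
  have hfr := h (Metric.ball (Y 0) (ε / Real.exp (L * |s|)))
    (Metric.ball_mem_nhds _ (by positivity))
  rw [frequently_atTop] at hfr ⊢
  intro a
  obtain ⟨b, hb, hbU⟩ := hfr (a - s)
  refine ⟨b + s, by linarith, hεU ?_⟩
  have hshift : ∀ t, HasDerivAt (fun t => X (b + t)) (F (X (b + t))) t := fun t =>
    (hX (b + t)).comp_const_add b t
  have := hF.dist_solution_le hshift hY s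
  refine Metric.mem_ball.2 (this.trans_lt ?_)
  rw [Metric.mem_ball, lt_div_iff₀ (Real.exp_pos _)] at hbU
  simpa using hbU

end GlobalODE

/-! ### Limit points of curves -/

section LimitPoints

variable {E : Type*} [TopologicalSpace E]

/-- A function that is non-increasing along a curve takes the same value at all limit points. -/
theorem MapClusterPt.eq_of_antitoneOn {X : ℝ → E} {W : E → ℝ} (hW : Continuous W)
    (hanti : AntitoneOn (fun t => W (X t)) (Set.Ici 0)) {y₁ y₂ : E}
    (h₁ : MapClusterPt y₁ atTop X) (h₂ : MapClusterPt y₂ atTop X) : W y₁ = W y₂ := by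
  have key : ∀ {y z : E}, MapClusterPt y atTop X → MapClusterPt z atTop X → W z ≤ W y := by
    intro y z hy hz
    -- Once `W` is strictly below `W z` along the curve it stays so, and the curve cannot return
    -- near `z`.
    have hlow : ∀ t ∈ Set.Ici (0 : ℝ), W z ≤ W (X t) := by
      intro t ht
      by_contra! hlt
      have := (mapClusterPt_iff_frequently.1 hz) _ ((isOpen_Ioi.preimage hW).mem_nhds hlt)
      obtain ⟨s, hs, hst⟩ := frequently_atTop.1 this t
      exact absurd (hanti ht (Set.mem_Ici.2 (le_trans ht hs)) hs) (not_le.2 hst)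
    by_contra! hlt
    have := (mapClusterPt_iff_frequently.1 hy) _ ((isOpen_Iio.preimage hW).mem_nhds hlt)
    obtain ⟨s, hs, hst⟩ := frequently_atTop.1 this 0
    exact absurd (hlow s hs) (not_le.2 hst)
  exact le_antisymm (key h₂ h₁) (key h₁ h₂)

/-- If a continuous function vanishes at all limit points of a curve in a compact set, it tends
to zero along this curve. -/
theorem tendsto_zero_of_mapClusterPt {X : ℝ → E} {A : Set E} (hA : IsCompact A)
    (hXA : ∀ᶠ t in atTop, X t ∈ A) {h : E → ℝ} (hh : Continuous h)
    (h0 : ∀ y, MapClusterPt y atTop X → h y = 0) : Tendsto (fun t => h (X t)) atTop (𝓝 0) := by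
  have hlim : Tendsto X atTop (𝓝ˢ {y | h y = 0}) :=
    hA.tendsto_nhdsSet_of_mapClusterPt hXA fun y _ hy => h0 y hy
  refine tendsto_nhds.2 fun U hU hU0 => ?_
  have hmem : h ⁻¹' U ∈ 𝓝ˢ {y | h y = 0} :=
    (hU.preimage hh).mem_nhdsSet.2 fun y hy => by
      rw [Set.mem_preimage, show h y = 0 from hy]; exact hU0
  exact hlim hmem

end LimitPoints

/-! ### Lyapunov functions and LaSalle's principle -/

section Lyapunov

variable {E : Type*} [NormedAddCommGroup E] {X : ℝ → E} {W R : E → ℝ} {x₀ : E} {r m : ℝ}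

/-- A curve along which `W` does not increase inside a ball cannot leave this ball through its
boundary sphere if `W` starts below its values on the sphere. -/
theorem mem_ball_of_lyapunov (hX : Continuous X)
    (hd : ∀ t, HasDerivAt (fun t => W (X t)) (R (X t)) t)
    (hR : ∀ x ∈ Metric.closedBall x₀ r, R x ≤ 0) (hm : ∀ x ∈ Metric.sphere x₀ r, m ≤ W x)
    (h0 : X 0 ∈ Metric.ball x₀ r) (h0m : W (X 0) < m) {T : ℝ} (hT : 0 ≤ T) :
    X T ∈ Metric.ball x₀ r := by
  by_contra hT'
  have hdc : Continuous fun t => dist (X t) x₀ := hX.dist continuous_const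
  have hAc : IsCompact (Set.Icc 0 T ∩ {t | r ≤ dist (X t) x₀}) :=
    isCompact_Icc.inter_right (isClosed_le continuous_const hdc)
  -- The first time outside the open ball; by the intermediate value theorem it is a time on the
  -- sphere.
  obtain ⟨τ, ⟨⟨hτ0, hτT⟩, hτ⟩, hmin⟩ :=
    hAc.exists_isLeast ⟨T, ⟨hT, le_rfl⟩, by simpa using hT'⟩
  obtain ⟨s, hs, hsr⟩ := intermediate_value_Icc hτ0 hdc.continuousOn
    (show r ∈ Set.Icc _ _ from ⟨(Metric.mem_ball.1 h0).le, hτ⟩)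
  have hsτ : s = τ := le_antisymm hs.2 (hmin ⟨⟨hs.1, hs.2.trans hτT⟩, hsr.ge⟩)
  subst hsτ
  have hanti : AntitoneOn (fun t => W (X t)) (Set.Icc 0 s) := by
    refine antitoneOn_of_deriv_nonpos (convex_Icc _ _)
      (fun t _ => (hd t).continuousAt.continuousWithinAt)
      (fun t _ => (hd t).differentiableAt.differentiableWithinAt) (fun t ht => ?_)
    rw [interior_Icc] at ht
    rw [(hd t).deriv]
    refine hR _ (Metric.mem_closedBall.2 ?_)
    by_contra! hlt
    exact absurd (hmin ⟨⟨ht.1.le, ht.2.le.trans hτT⟩, hlt.le⟩) (not_le.2 ht.2)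
  have h1 := hanti ⟨le_rfl, hτ0⟩ ⟨hτ0, le_rfl⟩ hτ0
  have h2 := hm _ (Metric.mem_sphere.2 hsr)
  exact absurd (h2.trans h1) (not_le.2 h0m)

variable [NormedSpace ℝ E] {F : E → E} {L : NNReal}

/-- **LaSalle's invariance principle**: through each limit point there is a global solution that
consists of limit points and along which the Lyapunov function is stationary. -/
theorem LipschitzWith.laSalle [CompleteSpace E] (hF : LipschitzWith L F) (hW : Continuous W)
    (hd : ∀ Y : ℝ → E, (∀ t, HasDerivAt Y (F (Y t)) t) →
      ∀ t, HasDerivAt (fun t => W (Y t)) (R (Y t)) t)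
    (hR : ∀ x ∈ Metric.closedBall x₀ r, R x ≤ 0)
    (hX : ∀ t, HasDerivAt X (F (X t)) t) (hXr : ∀ t, 0 ≤ t → X t ∈ Metric.closedBall x₀ r)
    {y : E} (hy : MapClusterPt y atTop X) :
    ∃ Y : ℝ → E, Y 0 = y ∧ (∀ t, HasDerivAt Y (F (Y t)) t) ∧
      ∀ t, MapClusterPt (Y t) atTop X ∧ R (Y t) = 0 := by
  obtain ⟨Y, hY0, hY⟩ := hF.exists_global_solution y
  subst hY0
  have hcl := hF.mapClusterPt_solution hX hY hy
  have hanti : AntitoneOn (fun t => W (X t)) (Set.Ici 0) := by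
    refine antitoneOn_of_deriv_nonpos (convex_Ici _)
      (fun t _ => (hd X hX t).continuousAt.continuousWithinAt)
      (fun t _ => (hd X hX t).differentiableAt.differentiableWithinAt) (fun t ht => ?_)
    rw [interior_Ici] at ht
    rw [(hd X hX t).deriv]
    exact hR _ (hXr t ht.le)
  refine ⟨Y, rfl, hY, fun t => ⟨hcl t, ?_⟩⟩
  -- All points of `Y` are limit points, so `W` is constant along it and its derivative `R`
  -- vanishes; continuity of `R` is not needed.
  have hconst : (fun t => W (Y t)) = fun _ => W (Y 0) :=
    funext fun s => MapClusterPt.eq_of_antitoneOn hW hanti (hcl s) (hcl 0)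
  have := hd Y hY t
  rw [hconst] at this
  exact this.unique (hasDerivAt_const _ _)

end Lyapunov

/-! ### Global Lipschitz continuity of the network vector field -/

section ExistsLipschitz

variable {E : Type*} [PseudoMetricSpace E]

theorem exists_lipschitzWith_pi {ι : Type*} [Fintype ι] {Y : ι → Type*}
    [∀ i, PseudoMetricSpace (Y i)] {f : E → ∀ i, Y i}
    (h : ∀ i, ∃ L, LipschitzWith L fun x => f x i) : ∃ L, LipschitzWith L f := by
  choose L hL using h
  refine ⟨Finset.univ.sup L, fun x y => edist_pi_le_iff.2 fun i => (hL i x y).trans ?_⟩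
  gcongr
  exact Finset.le_sup (Finset.mem_univ i)

theorem exists_lipschitzWith_prodMk {Y₁ Y₂ : Type*} [PseudoMetricSpace Y₁] [PseudoMetricSpace Y₂]
    {f₁ : E → Y₁} {f₂ : E → Y₂} (h₁ : ∃ L, LipschitzWith L f₁) (h₂ : ∃ L, LipschitzWith L f₂) :
    ∃ L, LipschitzWith L fun x => (f₁ x, f₂ x) :=
  let ⟨_, h₁⟩ := h₁; let ⟨_, h₂⟩ := h₂; ⟨_, h₁.prodMk h₂⟩

theorem exists_lipschitzWith_comp {Y₁ Y₂ : Type*} [PseudoMetricSpace Y₁] [PseudoMetricSpace Y₂]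
    {f₁ : E → Y₁} {f₂ : Y₁ → Y₂} (h₂ : ∃ L, LipschitzWith L f₂) (h₁ : ∃ L, LipschitzWith L f₁) :
    ∃ L, LipschitzWith L fun x => f₂ (f₁ x) :=
  let ⟨_, h₁⟩ := h₁; let ⟨_, h₂⟩ := h₂; ⟨_, h₂.comp h₁⟩

theorem exists_lipschitzWith_add {f₁ f₂ : E → ℝ} (h₁ : ∃ L, LipschitzWith L f₁)
    (h₂ : ∃ L, LipschitzWith L f₂) : ∃ L, LipschitzWith L fun x => f₁ x + f₂ x :=
  let ⟨_, h₁⟩ := h₁; let ⟨_, h₂⟩ := h₂; ⟨_, h₁.add h₂⟩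

theorem exists_lipschitzWith_neg {f₁ : E → ℝ} (h₁ : ∃ L, LipschitzWith L f₁) :
    ∃ L, LipschitzWith L fun x => -f₁ x :=
  let ⟨_, h₁⟩ := h₁; ⟨_, h₁.neg⟩

theorem exists_lipschitzWith_sub {f₁ f₂ : E → ℝ} (h₁ : ∃ L, LipschitzWith L f₁)
    (h₂ : ∃ L, LipschitzWith L f₂) : ∃ L, LipschitzWith L fun x => f₁ x - f₂ x :=
  let ⟨_, h₁⟩ := h₁; let ⟨_, h₂⟩ := h₂; ⟨_, h₁.sub h₂⟩

theorem exists_lipschitzWith_const_mul (c : ℝ) {f₁ : E → ℝ} (h₁ : ∃ L, LipschitzWith L f₁) :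
    ∃ L, LipschitzWith L fun x => c * f₁ x :=
  exists_lipschitzWith_comp ⟨_, lipschitzWith_smul c⟩ h₁

theorem exists_lipschitzWith_sum {ι : Type*} (s : Finset ι) {f : ι → E → ℝ}
    (h : ∀ i, ∃ L, LipschitzWith L (f i)) : ∃ L, LipschitzWith L fun x => ∑ i ∈ s, f i x := by
  classical
  induction s using Finset.induction_on with
  | empty => exact ⟨0, by simp⟩
  | insert a s ha ih =>
    simp only [Finset.sum_insert ha]
    exact exists_lipschitzWith_add (h a) ih

end ExistsLipschitz

namespace PowerNetwork

variable {N : Type*} [Fintype N] (G : PowerNetwork N)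

theorem exists_lipschitzWith_omega (j : N) :
    ∃ L, LipschitzWith L fun z : G.State => omega z.1 j :=
  ⟨_, (LipschitzWith.eval j).comp (LipschitzWith.prod_fst.comp
    (LipschitzWith.prod_snd.comp LipschitzWith.prod_fst))⟩

theorem exists_lipschitzWith_supply_input (j : N) :
    ∃ L, LipschitzWith L fun z : G.State => (supply z.1 j, -omega z.1 j) :=
  exists_lipschitzWith_prodMk
    ⟨_, (LipschitzWith.eval j).comp (LipschitzWith.prod_snd.comp
      (LipschitzWith.prod_snd.comp LipschitzWith.prod_fst))⟩
    (exists_lipschitzWith_neg (G.exists_lipschitzWith_omega j))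

theorem exists_lipschitzWith_lineFlow (e : G.E) :
    ∃ L, LipschitzWith L fun z : G.State => G.lineFlow z.1 e :=
  exists_lipschitzWith_const_mul _ (exists_lipschitzWith_comp ⟨1, Real.lipschitzWith_sin⟩
    ⟨_, (LipschitzWith.eval e).comp (LipschitzWith.prod_fst.comp LipschitzWith.prod_fst)⟩)

theorem exists_lipschitzWith_flowMap [DecidableEq N] : ∃ L, LipschitzWith L G.flowMap := by
  refine exists_lipschitzWith_prodMk (exists_lipschitzWith_prodMk ?_
    (exists_lipschitzWith_prodMk ?_ ?_)) ⟨0, LipschitzWith.const _⟩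
  · exact exists_lipschitzWith_pi fun e =>
      exists_lipschitzWith_sub (G.exists_lipschitzWith_omega _) (G.exists_lipschitzWith_omega _)
  · refine exists_lipschitzWith_pi fun j => exists_lipschitzWith_const_mul _ ?_
    refine exists_lipschitzWith_add (exists_lipschitzWith_sub (exists_lipschitzWith_sub
      (exists_lipschitzWith_add ⟨0, LipschitzWith.const _⟩ (exists_lipschitzWith_comp
        (G.g_lipschitz j) (G.exists_lipschitzWith_supply_input j)))
      (exists_lipschitzWith_const_mul _ ⟨_, (LipschitzWith.eval j).comp LipschitzWith.prod_snd⟩))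
      (exists_lipschitzWith_sum _ G.exists_lipschitzWith_lineFlow))
      (exists_lipschitzWith_sum _ G.exists_lipschitzWith_lineFlow)
  · exact exists_lipschitzWith_pi fun j => exists_lipschitzWith_comp (G.f_lipschitz j)
      (G.exists_lipschitzWith_supply_input j)

end PowerNetwork

/-! ### The energy function and its decay -/

/-- Turns sums over buses of frequency times power on incident lines into sums over lines. -/
theorem Finset.sum_mul_sum_fiber {ι κ R : Type*} [Fintype ι] [Fintype κ] [DecidableEq κ]
    [NonUnitalNonAssocSemiring R] (p : ι → κ) (w : κ → R) (a : ι → R) :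
    ∑ j, w j * ∑ i with p i = j, a i = ∑ i, w (p i) * a i := by
  rw [← Finset.sum_fiberwise Finset.univ p fun i => w (p i) * a i]
  refine Finset.sum_congr rfl fun j _ => ?_
  rw [Finset.mul_sum]
  refine Finset.sum_congr rfl fun i hi => ?_
  rw [(Finset.mem_filter.1 hi).2]

/-- The cosine lies strictly below its tangents on `[-π/2, π/2]`. -/
theorem Real.cos_lt_tangent {a b : ℝ} (ha : |a| < Real.pi / 2) (hb : |b| < Real.pi / 2)
    (hab : b ≠ a) :
    0 < cos a - cos b - (b - a) * sin a := by
  have ha' : a ∈ Set.Icc (-(Real.pi / 2)) (Real.pi / 2) := abs_le.1 ha.le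
  have hb' : b ∈ Set.Icc (-(Real.pi / 2)) (Real.pi / 2) := abs_le.1 hb.le
  rcases lt_or_gt_of_ne hab with h | h
  · have := strictConcaveOn_cos_Icc.lt_slope_of_hasDerivAt hb' ha' h (hasDerivAt_cos a)
    rw [slope_def_field, lt_div_iff₀ (by linarith)] at this
    linarith
  · have := strictConcaveOn_cos_Icc.slope_lt_of_hasDerivAt ha' hb' h (hasDerivAt_cos a)
    rw [slope_def_field, div_lt_iff₀ (by linarith)] at this
    linarith

namespace PowerNetwork

variable {N : Type*} (G : PowerNetwork N)

section

variable [Fintype N]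

theorem hasDerivAt_eta {X : ℝ → G.ContState} {t : ℝ} {v : G.ContState} (h : HasDerivAt X v t)
    (e : G.E) : HasDerivAt (fun s => eta (X s) e) (eta v e) t :=
  hasDerivAt_pi.1 h.fst e

theorem hasDerivAt_omega {X : ℝ → G.ContState} {t : ℝ} {v : G.ContState} (h : HasDerivAt X v t)
    (j : N) : HasDerivAt (fun s => omega (X s) j) (omega v j) t :=
  hasDerivAt_pi.1 h.snd.fst j

theorem hasDerivAt_supply {X : ℝ → G.ContState} {t : ℝ} {v : G.ContState} (h : HasDerivAt X v t)
    (j : N) : HasDerivAt (fun s => supply (X s) j) (supply v j) t :=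
  hasDerivAt_pi.1 h.snd.snd j

variable (xs : G.ContState) (V : ∀ j, EuclideanSpace ℝ (Fin (G.dim j)) → ℝ)

/-- The energy of the network relative to the equilibrium `xs`, with storage functions `V` of the
supply dynamics. -/
noncomputable def energy (x : G.ContState) : ℝ :=
  ∑ j, G.M j / 2 * omega x j ^ 2
    + ∑ e, G.B e * (Real.cos (eta xs e) - Real.cos (eta x e)
        - (eta x e - eta xs e) * Real.sin (eta xs e))
    + ∑ j, (V j (supply x j) - V j (supply xs j))

/-- The derivative of the energy along the network dynamics while all loads are off. -/
noncomputable def energyRate (x : G.ContState) : ℝ :=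
  ∑ j, (omega x j * (G.g j (supply x j, -omega x j) - G.g j (supply xs j, -omega xs j))
    + fderiv ℝ (V j) (supply x j) (G.f j (supply x j, -omega x j)))

theorem continuous_energy (hV : ∀ j, Continuous (V j)) : Continuous (G.energy xs V) := by
  have h1 : ∀ j, Continuous fun x : G.ContState => omega x j := fun j =>
    (continuous_apply j).comp (continuous_fst.comp continuous_snd)
  have h2 : ∀ e, Continuous fun x : G.ContState => eta x e := fun e =>
    (continuous_apply e).comp continuous_fst
  have h3 : ∀ j, Continuous fun x : G.ContState => V j (supply x j) := fun j =>
    (hV j).comp ((continuous_apply j).comp (continuous_snd.comp continuous_snd))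
  refine ((continuous_finsetSum _ fun j _ => ((h1 j).pow 2).const_mul _).add
    (continuous_finsetSum _ fun e _ => ?_)).add
    (continuous_finsetSum _ fun j _ => (h3 j).sub continuous_const)
  exact ((continuous_const.sub (Real.continuous_cos.comp (h2 e))).sub
    (((h2 e).sub continuous_const).mul continuous_const)).const_mul _

variable {xs V}

/-- Around a stationary point at nominal frequency there is a ball in which the energy is positive
definite and does not increase, the frequencies are nominal where it is stationary, and no load
switches on. -/
theorem exists_energy_ball (hω : ∀ j, omega xs j = 0) (hangle : ∀ e, |eta xs e| < Real.pi / 2)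
    (hV : ∀ j, IsPassivityStorage (G.f j) (G.g j) (-omega xs j) (supply xs j) (V j))
    (hmin : ∀ j, ∀ᶠ y in 𝓝[≠] (supply xs j), V j (supply xs j) < V j y) :
    ∃ r > 0, ∀ x ∈ Metric.closedBall xs r, (∀ j, |omega x j| < G.w0 j) ∧
      (x ≠ xs → 0 < G.energy xs V x) ∧ G.energyRate xs V x ≤ 0 ∧
      (G.energyRate xs V x = 0 → ∀ j, omega x j = 0) := by
  have h1 : ∀ j, Tendsto (fun x : G.ContState => omega x j) (𝓝 xs) (𝓝 (omega xs j)) := fun j =>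
    ((continuous_apply j).comp (continuous_fst.comp continuous_snd)).tendsto xs
  have h2 : ∀ e, Tendsto (fun x : G.ContState => eta x e) (𝓝 xs) (𝓝 (eta xs e)) := fun e =>
    ((continuous_apply e).comp continuous_fst).tendsto xs
  have h3 : ∀ j, Tendsto (fun x : G.ContState => supply x j) (𝓝 xs) (𝓝 (supply xs j)) := fun j =>
    ((continuous_apply j).comp (continuous_snd.comp continuous_snd)).tendsto xs
  choose U Y φ hUo hU hYo hY hφ0 hφ hdiss using fun j => (hV j).dissipation
  have e1 : ∀ᶠ x in 𝓝 xs, ∀ j, |omega x j| < G.w0 j := eventually_all.2 fun j =>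
    (h1 j).abs.eventually_lt_const (by rw [hω j, abs_zero]; exact G.w0_pos j)
  have e2 : ∀ᶠ x in 𝓝 xs, ∀ e, |eta x e| < Real.pi / 2 := eventually_all.2 fun e =>
    (h2 e).abs.eventually_lt_const (hangle e)
  have e3 : ∀ᶠ x in 𝓝 xs, ∀ j, -omega x j ∈ U j := eventually_all.2 fun j =>
    (h1 j).neg.eventually_mem ((hUo j).mem_nhds (hU j))
  have e4 : ∀ᶠ x in 𝓝 xs, ∀ j, supply x j ∈ Y j := eventually_all.2 fun j =>
    (h3 j).eventually_mem ((hYo j).mem_nhds (hY j))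
  have e5 : ∀ᶠ x in 𝓝 xs, ∀ j, supply x j ≠ supply xs j →
      V j (supply xs j) < V j (supply x j) := eventually_all.2 fun j =>
    (h3 j).eventually (eventually_nhdsWithin_iff.1 (hmin j))
  obtain ⟨r, hr, hball⟩ := Metric.nhds_basis_closedBall.eventually_iff.1
    ((((e1.and e2).and e3).and e4).and e5)
  refine ⟨r, hr, fun x hx => ?_⟩
  obtain ⟨⟨⟨⟨g1, g2⟩, g3⟩, g4⟩, g5⟩ := hball hx
  -- With input `-ω_j` and nominal equilibrium frequency, the passivity supply rate is the negative
  -- of the first term; only `-φ_j` is left.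
  have hd : ∀ j, omega x j * (G.g j (supply x j, -omega x j) - G.g j (supply xs j, -omega xs j))
      + fderiv ℝ (V j) (supply x j) (G.f j (supply x j, -omega x j)) ≤ -φ j (-omega x j) := by
    intro j
    have := hdiss j _ (g3 j) _ (g4 j)
    simp only [hω, neg_zero, sub_zero] at this ⊢
    linarith
  have hd0 : ∀ j, omega x j * (G.g j (supply x j, -omega x j) - G.g j (supply xs j, -omega xs j))
      + fderiv ℝ (V j) (supply x j) (G.f j (supply x j, -omega x j)) ≤ 0 := by
    intro j
    refine (hd j).trans ?_
    by_cases h : omega x j = 0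
    · simp [h, hφ0 j]
    · linarith [hφ j _ (neg_ne_zero.2 h)]
  refine ⟨g1, fun hne => ?_, Finset.sum_nonpos fun j _ => hd0 j, fun h0 j => ?_⟩
  · have p1 : ∀ j, 0 ≤ G.M j / 2 * omega x j ^ 2 := fun j => by
      have := G.M_pos j
      positivity
    have p2 : ∀ e, eta x e ≠ eta xs e → 0 < G.B e * (Real.cos (eta xs e) - Real.cos (eta x e)
        - (eta x e - eta xs e) * Real.sin (eta xs e)) := fun e he =>
      mul_pos (G.B_pos e) (Real.cos_lt_tangent (hangle e) (g2 e) he)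
    have p2' : ∀ e, 0 ≤ G.B e * (Real.cos (eta xs e) - Real.cos (eta x e)
        - (eta x e - eta xs e) * Real.sin (eta xs e)) := fun e => by
      by_cases he : eta x e = eta xs e
      · simp [he]
      · exact (p2 e he).le
    have p3 : ∀ j, 0 ≤ V j (supply x j) - V j (supply xs j) := fun j => by
      by_cases hj : supply x j = supply xs j
      · simp [hj]
      · linarith [g5 j hj]
    have s1 := Finset.sum_nonneg fun j (_ : j ∈ Finset.univ) => p1 j
    have s2 := Finset.sum_nonneg fun e (_ : e ∈ Finset.univ) => p2' e
    have s3 := Finset.sum_nonneg fun j (_ : j ∈ Finset.univ) => p3 j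
    unfold energy
    by_contra! hle
    have hzero : ∀ a b c : ℝ, 0 ≤ a → 0 ≤ b → 0 ≤ c → a + b + c ≤ 0 → a = 0 ∧ b = 0 ∧ c = 0 :=
      fun a b c ha hb hc h => ⟨by linarith, by linarith, by linarith⟩
    obtain ⟨z1, z2, z3⟩ := hzero _ _ _ s1 s2 s3 hle
    rw [Finset.sum_eq_zero_iff_of_nonneg fun j _ => p1 j] at z1
    rw [Finset.sum_eq_zero_iff_of_nonneg fun e _ => p2' e] at z2
    rw [Finset.sum_eq_zero_iff_of_nonneg fun j _ => p3 j] at z3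
    refine hne (Prod.ext ?_ (Prod.ext ?_ ?_))
    · funext e
      by_contra he
      exact (p2 e he).ne' (z2 e (Finset.mem_univ e))
    · funext j
      have := z1 j (Finset.mem_univ j)
      have hM := G.M_pos j
      have h0 : omega x j = 0 := by
        rcases mul_eq_zero.1 this with h | h
        · linarith
        · exact pow_eq_zero_iff two_ne_zero |>.1 h
      exact h0.trans (hω j).symm
    · funext j
      by_contra hj
      linarith [g5 j hj, z3 j (Finset.mem_univ j)]
  · by_contra h
    have := (Finset.sum_eq_zero_iff_of_nonpos fun j _ => hd0 j).1 h0 j (Finset.mem_univ j)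
    linarith [hd j, hφ j _ (neg_ne_zero.2 h)]

end

variable [DecidableEq N]

/-- The vector field of the continuous state while all on-off loads are off. -/
noncomputable def offField (x : G.ContState) : G.ContState := (G.flowMap (x, 0)).1

theorem omega_offField (x : G.ContState) (j : N) :
    G.M j * omega (G.offField x) j = -G.pL j + G.g j (supply x j, -omega x j)
      - ∑ e : G.E with e.1.1 = j, G.lineFlow x e + ∑ e : G.E with e.1.2 = j, G.lineFlow x e := by
  have : omega (G.offField x) j = (G.M j)⁻¹ * (-G.pL j + G.g j (supply x j, -omega x j)
      - G.dbar j * 0 - ∑ e : G.E with e.1.1 = j, G.lineFlow x e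
      + ∑ e : G.E with e.1.2 = j, G.lineFlow x e) := rfl
  rw [this, mul_inv_cancel_left₀ (G.M_pos j).ne', mul_zero, sub_zero]

variable [Fintype N]

theorem exists_lipschitzWith_offField : ∃ L, LipschitzWith L G.offField := by
  obtain ⟨L, hL⟩ := G.exists_lipschitzWith_flowMap
  exact ⟨_, LipschitzWith.prod_fst.comp (hL.comp (LipschitzWith.prodMk_right 0))⟩

variable {xs : G.ContState} {V : ∀ j, EuclideanSpace ℝ (Fin (G.dim j)) → ℝ}

/-- Subtracting the power balance at `xs` removes the constant load. Weighted by the frequencies and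
summed over the buses, the line terms become minus the rate of the line energy and cancel it. -/
theorem hasDerivAt_energy (hxs : G.offField xs = 0) (hV : ∀ j, Differentiable ℝ (V j))
    {X : ℝ → G.ContState} (hX : ∀ t, HasDerivAt X (G.offField (X t)) t) (t : ℝ) :
    HasDerivAt (fun s => G.energy xs V (X s)) (G.energyRate xs V (X t)) t := by
  have h1 : HasDerivAt (fun s => ∑ j, G.M j / 2 * omega (X s) j ^ 2)
      (∑ j, omega (X t) j * (G.M j * omega (G.offField (X t)) j)) t := by
    refine HasDerivAt.fun_sum fun j _ => ?_
    refine (((G.hasDerivAt_omega (hX t) j).fun_pow 2).const_mul (G.M j / 2)).congr_deriv ?_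
    push_cast
    ring
  have h2 : HasDerivAt (fun s => ∑ e, G.B e * (Real.cos (eta xs e) - Real.cos (eta (X s) e)
        - (eta (X s) e - eta xs e) * Real.sin (eta xs e)))
      (∑ e : G.E, (omega (X t) e.1.1 - omega (X t) e.1.2) *
        (G.lineFlow (X t) e - G.lineFlow xs e)) t := by
    refine HasDerivAt.fun_sum fun e _ => ?_
    have he := G.hasDerivAt_eta (hX t) e
    have he' : eta (G.offField (X t)) e = omega (X t) e.1.1 - omega (X t) e.1.2 := rfl
    rw [he'] at he
    refine (((he.cos.const_sub (Real.cos (eta xs e))).fun_sub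
      ((he.sub_const (eta xs e)).mul_const
        (Real.sin (eta xs e)))).const_mul (G.B e)).congr_deriv ?_
    unfold lineFlow
    ring
  have h3 : HasDerivAt (fun s => ∑ j, (V j (supply (X s) j) - V j (supply xs j)))
      (∑ j, fderiv ℝ (V j) (supply (X t) j) (G.f j (supply (X t) j, -omega (X t) j))) t := by
    refine HasDerivAt.fun_sum fun j _ => ?_
    exact ((hV j _).hasFDerivAt.comp_hasDerivAt t (G.hasDerivAt_supply (hX t) j)).sub_const _
  refine ((h1.fun_add h2).fun_add h3).congr_deriv ?_
  unfold energyRate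
  rw [Finset.sum_add_distrib, add_left_inj]
  have hbal : ∀ j, G.M j * omega (G.offField (X t)) j
      = (G.g j (supply (X t) j, -omega (X t) j) - G.g j (supply xs j, -omega xs j))
        - ∑ e : G.E with e.1.1 = j, (G.lineFlow (X t) e - G.lineFlow xs e)
        + ∑ e : G.E with e.1.2 = j, (G.lineFlow (X t) e - G.lineFlow xs e) := by
    intro j
    have h0 := G.omega_offField xs j
    rw [hxs, show omega (0 : G.ContState) j = 0 from rfl, mul_zero] at h0
    rw [G.omega_offField, Finset.sum_sub_distrib, Finset.sum_sub_distrib]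
    linarith
  simp only [hbal, mul_add, mul_sub, Finset.sum_add_distrib, Finset.sum_sub_distrib, sub_mul,
    Finset.sum_mul_sum_fiber (fun e : G.E => e.1.1), Finset.sum_mul_sum_fiber (fun e : G.E => e.1.2)]
  ring

end PowerNetwork

/-! ### Hybrid time domains -/

namespace IsHybridTimeDomain

variable {K : Set (ℝ × ℕ)}

theorem nonneg (hK : IsHybridTimeDomain K) {p : ℝ × ℕ} (hp : p ∈ K) : 0 ≤ p.1 := by
  obtain ⟨t, h0, hmono, rfl | ⟨J, I, hI, rfl⟩⟩ := hK
  · exact (h0 ▸ hmono (Nat.zero_le p.2)).trans hp.1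
  · rcases hp with ⟨_, hp⟩ | ⟨_, hp⟩
    · exact (h0 ▸ hmono (Nat.zero_le p.2)).trans hp.1
    · refine (h0 ▸ hmono (Nat.zero_le J) : 0 ≤ t J).trans ?_
      rcases hI with ⟨T, hT, rfl⟩ | ⟨T, hT, rfl⟩ | rfl
      · exact hp.1
      · exact hp.1
      · exact hp

theorem Icc_subset_slice (hK : IsHybridTimeDomain K) {T : ℝ} (hT : (T, 0) ∈ K) :
    Set.Icc 0 T ⊆ hybridSlice K 0 := by
  rintro s ⟨hs0, hsT⟩
  obtain ⟨t, h0, hmono, rfl | ⟨J, I, hI, rfl⟩⟩ := hK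
  · exact ⟨h0.le.trans hs0, hsT.trans hT.2⟩
  · rcases hT with ⟨hJ, hT⟩ | ⟨rfl, hT⟩
    · exact Or.inl ⟨hJ, h0.le.trans hs0, hsT.trans hT.2⟩
    · refine Or.inr ⟨rfl, ?_⟩
      rcases hI with ⟨T', hT', rfl⟩ | ⟨T', hT', rfl⟩ | rfl
      · exact ⟨h0.le.trans hs0, hsT.trans hT.2⟩
      · exact ⟨h0.le.trans hs0, hsT.trans_lt hT.2⟩
      · exact h0.le.trans hs0

/-- A time domain that goes beyond the first interval contains the time of the first jump. -/
theorem exists_first_jump (hK : IsHybridTimeDomain K) {p : ℝ × ℕ} (hp : p ∈ K) (hp2 : p.2 ≠ 0) :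
    ∃ τ : ℝ, (τ, 0) ∈ K ∧ (τ, 1) ∈ K := by
  obtain ⟨t, h0, hmono, rfl | ⟨J, I, hI, rfl⟩⟩ := hK
  · exact ⟨t 1, ⟨hmono (Nat.zero_le 1), le_rfl⟩, le_rfl, hmono (Nat.le_succ 1)⟩
  · have hJ : 0 < J := by
      rcases hp with ⟨h, _⟩ | ⟨h, _⟩ <;> omega
    refine ⟨t 1, Or.inl ⟨hJ, hmono (Nat.zero_le 1), le_rfl⟩, ?_⟩
    rcases Nat.lt_or_ge 1 J with h | h
    · exact Or.inl ⟨h, le_rfl, hmono (Nat.le_succ 1)⟩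
    · obtain rfl : J = 1 := by omega
      refine Or.inr ⟨rfl, ?_⟩
      rcases hI with ⟨T, hT, rfl⟩ | ⟨T, hT, rfl⟩ | rfl
      · exact ⟨le_rfl, hT⟩
      · exact ⟨le_rfl, hT⟩
      · exact le_rfl (a := t 1)

end IsHybridTimeDomain

theorem isHybridTimeDomain_ray : IsHybridTimeDomain {p : ℝ × ℕ | 0 ≤ p.1 ∧ p.2 = 0} := by
  refine ⟨fun _ => 0, rfl, monotone_const, Or.inr ⟨0, Set.Ici 0, Or.inr (Or.inr rfl), ?_⟩⟩
  ext p
  simp [and_comm]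

theorem not_isBounded_ray : ¬ Bornology.IsBounded {p : ℝ × ℕ | 0 ≤ p.1 ∧ p.2 = 0} := by
  intro h
  obtain ⟨c, hc⟩ := Metric.isBounded_iff.1 h
  have h1 := hc (x := ((0 : ℝ), 0)) ⟨le_rfl, rfl⟩ (y := (|c| + 1, 0)) ⟨by positivity, rfl⟩
  have h2 : dist (0 : ℝ) (|c| + 1) ≤ c := (le_max_left _ _).trans h1
  rw [Real.dist_eq, zero_sub, abs_neg, abs_of_pos (by positivity)] at h2
  linarith [le_abs_self c]

theorem tendsto_fst_hybridAtTop_ray :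
    Tendsto (fun p : ℝ × ℕ => p.1) (hybridAtTop {p : ℝ × ℕ | 0 ≤ p.1 ∧ p.2 = 0}) atTop := by
  refine Tendsto.congr' ?_ (tendsto_comap.mono_left inf_le_left :
    Tendsto (fun p : ℝ × ℕ => p.1 + (p.2 : ℝ)) _ _)
  filter_upwards [mem_inf_of_right (mem_principal_self _)] with p hp
  simp [hp.2]

/-! ### Equilibria, solutions with all loads off, and their limit points -/

namespace PowerNetwork

variable {N : Type*} (G : PowerNetwork N)

theorem compat_of_abs_lt {j : N} {w : ℝ} (h : |w| < G.w0 j) : G.compat j w = {0} := if_pos h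

theorem mem_domain_of_abs_lt {x : G.ContState} (h : ∀ j, |omega x j| < G.w0 j) :
    ((x, 0) : G.State) ∈ G.domain := fun j => by
  rw [G.compat_of_abs_lt (h j)]
  simp

theorem notMem_D_of_abs_lt {z : G.State} (h : ∀ j, |omega z.1 j| < G.w0 j) : z ∉ G.D := by
  rintro ⟨_, j, ⟨hj, _⟩ | ⟨hj, _⟩⟩
  · linarith [h j, G.w0_lt_w1 j]
  · linarith [h j]

theorem omega_eq_of_forall_edge {w : N → ℝ} (h : ∀ e : G.E, w e.1.1 = w e.1.2) (i j : N) :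
    w i = w j := by
  obtain ⟨p⟩ := G.connected.preconnected i j
  induction p with
  | nil => rfl
  | cons hadj _ ih =>
    rw [← ih]
    rcases ((SimpleGraph.fromRel_adj _ _ _).1 hadj).2 with h' | h'
    · exact h ⟨_, h'⟩
    · exact (h ⟨_, h'⟩).symm

variable [Fintype N] [DecidableEq N]

/-- Equilibria have nominal frequency, and all their on-off loads are off. -/
theorem equilibrium_nominal (hnom : G.NominalFrequency) {z : G.State}
    (hz : z ∈ G.hybrid.equilibria) :
    (∀ j, omega z.1 j = 0) ∧ G.offField z.1 = 0 := by
  have hdom : z ∈ G.domain := by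
    rcases hz.1 with h | h
    · exact h.1
    · exact h.1
  -- Points of the jump set also lie in the flow set, so the flow vanishes at every equilibrium.
  have hflow : G.flowMap z = 0 := hz.2.1 ⟨hdom, fun j => (hdom j).2⟩
  have hedge : ∀ e : G.E, omega z.1 e.1.1 = omega z.1 e.1.2 := fun e =>
    sub_eq_zero.1 (congrArg (fun v : G.State => eta v.1 e) hflow)
  have hsup : ∀ j, G.f j (supply z.1 j, -omega z.1 j) = 0 := fun j =>
    congrArg (fun v : G.State => supply v.1 j) hflow
  obtain ⟨k, hk⟩ := hnom
  have hω : ∀ j, omega z.1 j = 0 := fun j =>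
    (G.omega_eq_of_forall_edge hedge j k).trans (hk _ _ (hsup k))
  have hσ : z.2 = 0 := funext fun j => by
    have := (hdom j).2
    rwa [G.compat_of_abs_lt (by rw [hω j, abs_zero]; exact G.w0_pos j)] at this
  refine ⟨hω, ?_⟩
  have : z = (z.1, 0) := Prod.ext rfl hσ
  rw [this] at hflow
  exact congrArg Prod.fst hflow

theorem mem_equilibria_of_offField {x : G.ContState} (hω : ∀ j, omega x j = 0)
    (hx : G.offField x = 0) : ((x, 0) : G.State) ∈ G.hybrid.equilibria := by
  have hlt : ∀ j, |omega x j| < G.w0 j := fun j => by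
    rw [hω j, abs_zero]
    exact G.w0_pos j
  have hdom := G.mem_domain_of_abs_lt hlt
  refine ⟨Or.inl ⟨hdom, fun j => (hdom j).2⟩, fun _ => Prod.ext hx rfl, fun hD => ?_⟩
  exact absurd hD (G.notMem_D_of_abs_lt hlt)

theorem hasDerivAt_off_state {X : ℝ → G.ContState}
    (hX : ∀ t, HasDerivAt X (G.offField (X t)) t) (t : ℝ) :
    HasDerivAt (fun s => ((X s, 0) : G.State)) (G.flowMap (X t, 0)) t :=
  (hX t).prodMk (hasDerivAt_const t (0 : N → ℝ))

/-- A curve of the network dynamics on which no load switches on is a solution of the hybrid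
system. -/
theorem isSolution_off {X : ℝ → G.ContState} (hX : ∀ t, HasDerivAt X (G.offField (X t)) t)
    (hlt : ∀ t, 0 ≤ t → ∀ j, |omega (X t) j| < G.w0 j) :
    G.hybrid.IsSolution {p : ℝ × ℕ | 0 ≤ p.1 ∧ p.2 = 0} fun p => (X p.1, 0) := by
  have hd := G.hasDerivAt_off_state hX
  have hC : ∀ t, 0 ≤ t → ((X t, 0) : G.State) ∈ G.C := fun t ht =>
    have hdom := G.mem_domain_of_abs_lt (hlt t ht)
    ⟨hdom, fun j => (hdom j).2⟩
  obtain ⟨L, hL⟩ := G.exists_lipschitzWith_flowMap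
  refine ⟨isHybridTimeDomain_ray, fun l a b _ _ => ?_, Or.inl (hC 0 le_rfl),
    fun l t ht => hC t (interior_subset ht).1, fun l _ => ae_of_all _ fun t _ => hd t, ?_⟩
  · refine ContDiffOn.absolutelyContinuousOnInterval (ContDiff.contDiffOn ?_)
    rw [contDiff_one_iff_deriv]
    refine ⟨fun t => (hd t).differentiableAt, ?_⟩
    rw [show deriv (fun t => ((X t, 0) : G.State)) = fun t => G.flowMap (X t, 0) from
      funext fun t => (hd t).deriv]
    exact hL.continuous.comp (continuous_iff_continuousAt.2 fun t => (hd t).continuousAt)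
  · rintro t l _ ⟨_, h⟩
    exact absurd h (Nat.succ_ne_zero l)

/-- A maximal solution that starts on a curve of the network dynamics on which no load switches on
is complete and follows this curve. -/
theorem maximalSolution_eq_off {X : ℝ → G.ContState}
    (hX : ∀ t, HasDerivAt X (G.offField (X t)) t)
    (hlt : ∀ t, 0 ≤ t → ∀ j, |omega (X t) j| < G.w0 j) {K : Set (ℝ × ℕ)} {z : ℝ × ℕ → G.State}
    (hz : G.hybrid.IsMaximalSolution K z) (h0 : z (0, 0) = (X 0, 0)) :
    K = {p : ℝ × ℕ | 0 ≤ p.1 ∧ p.2 = 0} ∧ ∀ p ∈ K, z p = (X p.1, 0) := by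
  obtain ⟨hsol, hmax⟩ := hz
  obtain ⟨L, hL⟩ := G.exists_lipschitzWith_flowMap
  have hslice : ∀ T, (T, 0) ∈ K → z (T, 0) = (X T, 0) := by
    intro T hT
    have hT0 : 0 ≤ T := hsol.domain.nonneg hT
    -- The differential equation is only available on slices with nonempty interior, so `T = 0` is
    -- separate.
    rcases hT0.eq_or_lt with rfl | hpos
    · exact h0
    have hsub := hsol.domain.Icc_subset_slice hT
    have hne : (interior (hybridSlice K 0)).Nonempty :=
      (Set.nonempty_Ioo.2 hpos).mono (interior_maximal (Set.Ioo_subset_Icc_self.trans hsub)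
        isOpen_Ioo)
    refine hL.eqOn_of_absolutelyContinuous (y := fun t => z (t, 0))
      (X := fun t => ((X t, 0) : G.State)) hT0 (hsol.locallyAbsCont 0 0 T hT0 hsub) ?_
      (G.hasDerivAt_off_state hX) h0.symm ⟨hT0, le_rfl⟩
    filter_upwards [hsol.flow_eq 0 hne] with t ht htm using ht (hsub htm)
  have hzero : ∀ p ∈ K, p.2 = 0 := by
    intro p hp
    by_contra hp2
    obtain ⟨τ, h1, h2⟩ := hsol.domain.exists_first_jump hp hp2
    have hD : z (τ, 0) ∈ G.D := (hsol.jump_eq τ 0 h1 h2).1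
    rw [hslice τ h1] at hD
    exact G.notMem_D_of_abs_lt (hlt τ (hsol.domain.nonneg h1)) hD
  have hzX : ∀ p ∈ K, z p = (X p.1, 0) := by
    rintro ⟨t, l⟩ hp
    obtain rfl : l = 0 := hzero _ hp
    exact hslice t hp
  refine ⟨?_, hzX⟩
  have hsub : K ⊆ {p : ℝ × ℕ | 0 ≤ p.1 ∧ p.2 = 0} := fun p hp =>
    ⟨hsol.domain.nonneg hp, hzero p hp⟩
  -- On a smaller time domain the curve on the whole ray would be a proper extension.
  by_contra hne
  exact hmax ⟨_, _, G.isSolution_off hX hlt, hsub.ssubset_of_ne hne, fun p hp => (hzX p hp).symm⟩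

/-- Limit points of a bounded curve of the network dynamics along which the energy does not
increase are stationary points at nominal frequency. -/
theorem stationary_of_mapClusterPt (hreg : G.SupplyRegular) {xs : G.ContState} {r : ℝ}
    {W R : G.ContState → ℝ} (hW : Continuous W)
    (hd : ∀ Y : ℝ → G.ContState, (∀ t, HasDerivAt Y (G.offField (Y t)) t) →
      ∀ t, HasDerivAt (fun t => W (Y t)) (R (Y t)) t)
    (hR : ∀ x ∈ Metric.closedBall xs r, R x ≤ 0 ∧ (R x = 0 → ∀ j, omega x j = 0))
    {X : ℝ → G.ContState} (hX : ∀ t, HasDerivAt X (G.offField (X t)) t)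
    (hXr : ∀ t, 0 ≤ t → X t ∈ Metric.closedBall xs r) {y : G.ContState}
    (hy : MapClusterPt y atTop X) : (∀ j, omega y j = 0) ∧ G.offField y = 0 := by
  obtain ⟨L, hL⟩ := G.exists_lipschitzWith_offField
  have hball : ∀ x, MapClusterPt x atTop X → x ∈ Metric.closedBall xs r := fun x hx =>
    Metric.isClosed_closedBall.mem_of_mapClusterPt hx ((eventually_ge_atTop 0).mono hXr)
  have hlas : ∀ x, MapClusterPt x atTop X → ∃ Y : ℝ → G.ContState, Y 0 = x ∧
      (∀ t, HasDerivAt Y (G.offField (Y t)) t) ∧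
      ∀ t, MapClusterPt (Y t) atTop X ∧ ∀ j, omega (Y t) j = 0 := by
    intro x hx
    obtain ⟨Y, hY0, hY, hYR⟩ := hL.laSalle hW hd (fun x hx => (hR x hx).1) hX hXr hx
    exact ⟨Y, hY0, hY, fun t => ⟨(hYR t).1, (hR _ (hball _ (hYR t).1)).2 (hYR t).2⟩⟩
  obtain ⟨Y, rfl, hY, hYc⟩ := hlas y hy
  refine ⟨(hYc 0).2, Prod.ext (funext fun e => ?_) (Prod.ext (funext fun j => ?_)
    (funext fun j => ?_))⟩
  · exact sub_eq_zero.2 (((hYc 0).2 _).trans ((hYc 0).2 _).symm)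
  · have h1 := G.hasDerivAt_omega (hY 0) j
    rw [show (fun s => omega (Y s) j) = fun _ => 0 from funext fun s => (hYc s).2 j] at h1
    exact h1.unique (hasDerivAt_const _ _)
  · have hcont : Continuous fun x : G.ContState => supply x j :=
      (continuous_apply j).comp (continuous_snd.comp continuous_snd)
    have hcpt : IsCompact ((fun x : G.ContState => supply x j) '' {x | MapClusterPt x atTop X}) :=
      ((isCompact_closedBall xs r).of_isClosed_subset isClosed_setOfPred_clusterPt hball).image hcont
    have hf : ∀ x : G.ContState, omega x j = 0 →
        supply (G.offField x) j = G.f j (supply x j, -0) := fun x hx => by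
      rw [← hx]
      rfl
    have := (hreg j).2 0 _ hcpt ?_ (supply (Y 0) j) ⟨Y 0, hy, rfl⟩
    · exact (hf _ ((hYc 0).2 j)).trans this
    -- The LaSalle trajectory through `x` has zero frequency, so its supply component solves the
    -- equation with zero input and stays in the image.
    · rintro _ ⟨x, hx, rfl⟩
      obtain ⟨Z, rfl, hZ, hZc⟩ := hlas x hx
      refine ⟨fun t => supply (Z t) j, rfl, fun t => ?_, fun t => ⟨Z t, (hZc t).1, rfl⟩⟩
      exact (G.hasDerivAt_supply (hZ t) j).congr_deriv (hf _ ((hZc t).2 j))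

end PowerNetwork

/-! ### Local convergence to the equilibria -/

theorem theorem2 {N : Type*} [Fintype N] [DecidableEq N] (G : PowerNetwork N)
    (hreg : G.SupplyRegular) (hnom : G.NominalFrequency)
    (zstar : G.State) (hzstar : zstar ∈ G.hybrid.equilibria)
    (hpass : G.PassiveAt zstar.1)
    (hangle : ∀ e, |PowerNetwork.eta zstar.1 e| < Real.pi / 2) :
    ∃ S : Set G.ContState, IsOpen S ∧ zstar.1 ∈ S ∧
      ∀ (K : Set (ℝ × ℕ)) (z : ℝ × ℕ → G.State), G.hybrid.IsMaximalSolution K z →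
        (z (0, 0)).1 ∈ S →
        (∀ j, (z (0, 0)).2 j ∈ G.compat j (PowerNetwork.omega (z (0, 0)).1 j)) →
        ¬ Bornology.IsBounded K ∧
        Tendsto (fun p => Metric.infDist (z p) G.hybrid.equilibria) (hybridAtTop K) (𝓝 0) ∧
        Tendsto (fun p => PowerNetwork.omega (z p).1) (hybridAtTop K) (𝓝 0) ∧
        Tendsto (fun p => (z p).2) (hybridAtTop K) (𝓝 0) := by
  obtain ⟨hω, hoff⟩ := G.equilibrium_nominal hnom hzstar
  choose V hV hmin using hpass
  obtain ⟨r, hr, hball⟩ := G.exists_energy_ball hω hangle hV hmin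
  have hWc : Continuous (G.energy zstar.1 V) :=
    G.continuous_energy _ _ fun j => (hV j).contDiff.continuous
  have hWd : ∀ Y : ℝ → G.ContState, (∀ t, HasDerivAt Y (G.offField (Y t)) t) →
      ∀ t, HasDerivAt (fun t => G.energy zstar.1 V (Y t)) (G.energyRate zstar.1 V (Y t)) t :=
    fun _ hY => G.hasDerivAt_energy hoff
      (fun j => (hV j).contDiff.differentiable one_ne_zero) hY
  have hW0 : G.energy zstar.1 V zstar.1 = 0 := by
    simp [PowerNetwork.energy, hω]
  obtain ⟨m, hm0, hm⟩ := (isCompact_sphere zstar.1 r).exists_forall_le' hWc.continuousOn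
    (a := 0) fun x hx => (hball x (Metric.sphere_subset_closedBall hx)).2.1
      (Metric.ne_of_mem_sphere hx hr.ne')
  refine ⟨Metric.ball zstar.1 r ∩ {x | G.energy zstar.1 V x < m},
    Metric.isOpen_ball.inter (isOpen_lt hWc continuous_const),
    ⟨Metric.mem_ball_self hr, by rw [Set.mem_ofPred_eq, hW0]; exact hm0⟩, ?_⟩
  intro K z hz hx0 hσ0
  obtain ⟨L, hL⟩ := G.exists_lipschitzWith_offField
  obtain ⟨X, hX0, hX⟩ := hL.exists_global_solution (z (0, 0)).1
  rw [← hX0] at hx0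
  have hXc : Continuous X := continuous_iff_continuousAt.2 fun t => (hX t).continuousAt
  have hXr : ∀ t, 0 ≤ t → X t ∈ Metric.closedBall zstar.1 r := fun t ht =>
    Metric.ball_subset_closedBall (mem_ball_of_lyapunov hXc (hWd X hX)
      (fun x hx => (hball x hx).2.2.1) hm hx0.1 hx0.2 ht)
  have hlt : ∀ t, 0 ≤ t → ∀ j, |PowerNetwork.omega (X t) j| < G.w0 j := fun t ht =>
    (hball _ (hXr t ht)).1
  -- Below the lower thresholds, compatibility forces the initial discrete state to be zero.
  have h0 : z (0, 0) = (X 0, 0) := by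
    refine Prod.ext hX0.symm (funext fun j => ?_)
    have := hσ0 j
    rwa [← hX0, G.compat_of_abs_lt (hlt 0 le_rfl j)] at this
  obtain ⟨rfl, hzX⟩ := G.maximalSolution_eq_off hX hlt hz h0
  have hlim : ∀ y, MapClusterPt y atTop X →
      (∀ j, PowerNetwork.omega y j = 0) ∧ G.offField y = 0 := fun y hy =>
    G.stationary_of_mapClusterPt hreg hWc hWd (fun x hx => (hball x hx).2.2) hX hXr hy
  have hfst := tendsto_fst_hybridAtTop_ray
  have hmem : ∀ᶠ p in hybridAtTop {p : ℝ × ℕ | 0 ≤ p.1 ∧ p.2 = 0}, z p = (X p.1, 0) := by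
    filter_upwards [mem_inf_of_right (mem_principal_self _)] with p hp using hzX p hp
  have hXA : ∀ᶠ t in atTop, X t ∈ Metric.closedBall zstar.1 r := (eventually_ge_atTop 0).mono hXr
  refine ⟨not_isBounded_ray, ?_, ?_, ?_⟩
  -- The set of equilibria contains `zstar`, so `Metric.infDist` does not take its default value for
  -- the empty set.
  · have hc : Continuous fun x : G.ContState =>
        Metric.infDist ((x, 0) : G.State) G.hybrid.equilibria :=
      (Metric.continuous_infDist_pt _).comp (continuous_id.prodMk continuous_const)
    refine ((tendsto_zero_of_mapClusterPt (isCompact_closedBall _ _) hXA hc fun y hy =>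
      Metric.infDist_zero_of_mem (G.mem_equilibria_of_offField (hlim y hy).1
        (hlim y hy).2)).comp hfst).congr' ?_
    filter_upwards [hmem] with p hp
    rw [hp, Function.comp]
  · have hc : Continuous fun x : G.ContState => ‖PowerNetwork.omega x‖ :=
      (continuous_fst.comp continuous_snd).norm
    refine tendsto_zero_iff_norm_tendsto_zero.2 (((tendsto_zero_of_mapClusterPt
      (isCompact_closedBall _ _) hXA hc fun y hy => norm_eq_zero.2
        (funext (hlim y hy).1)).comp hfst).congr' ?_)
    filter_upwards [hmem] with p hp
    rw [hp, Function.comp]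
  · refine tendsto_const_nhds.congr' ?_
    filter_upwards [hmem] with p hp
    rw [hp]
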